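/- Let $L>0$ and let $\mathcal D$ be a real distribution on $[0,L]$, i.e. a continuous linear form on the Fréchet space $C^\infty([0,L])$ (complex-valued functions, seminorms $\sup_{[0,L]}|f^{(k)}|$) that takes real values on real functions. For a function $f$ on $[-L,L]$ whose restrictions to $[0,L]$ and to $[-L,0]$ are smooth, put $\widetilde{\mathcal D}(f)=\mathcal D(f)+\mathcal D(\tilde f)$, where $\tilde f(x)=f(-x)$. Let $U_n(x)=L^{-1/2}e^{2\pi i n x/L}$ for $x\in[0,L]$ and $U_n(x)=0$ for $x\notin[0,L]$ ($n\in\mathbb Z$), and call the finite linear combinations of the $U_n$ trigonometric polynomials. On trigonometric polynomials consider the Hermitian form $$\langle f\mid g\rangle_Q=\widetilde{\mathcal D}(f^**g),\qquad f^*(x)=\overline{f(-x)},\qquad (f*g)(y)=\int_{\mathbb R} f(x)\,g(y-x)\,dx .$$ Assume that this form defines a lower-bounded essentially selfadjoint operator in $L^2([0,L],dx)$: there is a linear operator $T$, whose domain is the space of trigonometric polynomials, with $\langle f\mid Tg\rangle=\langle f\mid g\rangle_Q$ for all trigonometric polynomials $f,g$; there is $c\in\mathbb R$ with $\langle f\mid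 Tf\rangle\ge c\|f\|^2$ for all $f$ in the domain; and the closure $A=\overline T$ is selfadjoint. Assume that the minimum $\lambda$ of the spectrum of $A$ is an isolated point of the spectrum and a simple eigenvalue of $A$ (its eigenspace is one-dimensional), and that an eigenfunction $\xi\neq 0$, $A\xi=\lambda\xi$, is even, i.e. $\xi(L-x)=\xi(x)$ for almost every $x\in[0,L]$. Then $$\widehat\xi(z)=\int_0^L \xi(x)\,e^{-izx}\,dx,\qquad z\in\mathbb C,$$ is an entire function, and all its zeros lie on the real line. -/

import Mathlib

open MeasureTheory Set Topology
open scoped ContDiff InnerProductSpace ComplexConjugate Convolution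

noncomputable section

namespace DistForm

/-! ### Distributions on a compact interval -/

/-- The functions that are smooth on `[0, L]` (one-sided derivatives at the end points). Values
outside `[0, L]` are irrelevant: distributions below do not see them. -/
def smoothOn (L : ℝ) : Submodule ℂ (ℝ → ℂ) where
  carrier := {f | ContDiffOn ℝ ∞ f (Icc 0 L)}
  add_mem' hf hg := ContDiffOn.add hf hg
  zero_mem' := contDiffOn_const
  smul_mem' c _ hf := ContDiffOn.const_smul c hf

/-- A real distribution on `[0, L]`: a linear form on `C^∞([0, L])` that is continuous for the
Fréchet topology given by the seminorms `sup_{[0, L]} |f^{(k)}|`, and takes real values on real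
functions. The continuity estimate makes the value depend only on the restriction to `[0, L]`. -/
structure RealDistribution (L : ℝ) where
  toLinearMap : smoothOn L →ₗ[ℂ] ℂ
  continuous' : ∃ (N : ℕ) (C : ℝ), ∀ (f : smoothOn L) (M : ℝ),
    (∀ k ≤ N, ∀ x ∈ Icc (0 : ℝ) L, ‖iteratedDerivWithin k (f : ℝ → ℂ) (Icc 0 L) x‖ ≤ M) →
      ‖toLinearMap f‖ ≤ C * M
  real' : ∀ f : smoothOn L, (∀ x ∈ Icc (0 : ℝ) L, ((f : ℝ → ℂ) x).im = 0) →
    (toLinearMap f).im = 0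

/-- The functions whose restrictions to `[0, L]` and to `[-L, 0]` are smooth
(not necessarily smooth at `0`). -/
def piecewiseSmoothOn (L : ℝ) : Submodule ℂ (ℝ → ℂ) where
  carrier := {f | ContDiffOn ℝ ∞ f (Icc 0 L) ∧ ContDiffOn ℝ ∞ f (Icc (-L) 0)}
  add_mem' hf hg := ⟨hf.1.add hg.1, hf.2.add hg.2⟩
  zero_mem' := ⟨contDiffOn_const, contDiffOn_const⟩
  smul_mem' c _ hf := ⟨hf.1.const_smul c, hf.2.const_smul c⟩

lemma reflect_mem {L : ℝ} (f : piecewiseSmoothOn L) :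
    (fun x => (f : ℝ → ℂ) (-x)) ∈ smoothOn L := by
  have h : ContDiffOn ℝ ∞ (fun x : ℝ => -x) (Icc 0 L) := contDiff_neg.contDiffOn
  refine ContDiffOn.comp f.2.2 h ?_
  intro x hx
  exact ⟨by linarith [hx.2], by linarith [hx.1]⟩

/-- The symmetrized distribution `D̃(f) = D(f) + D(f̃)`, `f̃(x) = f(-x)`. -/
def RealDistribution.symm {L : ℝ} (D : RealDistribution L) (f : piecewiseSmoothOn L) : ℂ :=
  D.toLinearMap ⟨f, f.2.1⟩ + D.toLinearMap ⟨fun x => (f : ℝ → ℂ) (-x), reflect_mem f⟩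

/-! ### Trigonometric polynomials and the Hermitian form -/

/-- `exp (2 π i n x / L) / √L` on the whole line. -/
def expFun (L : ℝ) (n : ℤ) (x : ℝ) : ℂ :=
  ((Real.sqrt L)⁻¹ : ℝ) * Complex.exp (2 * Real.pi * Complex.I * n * x / L)

/-- The basis function `U_n`, equal to `L^{-1/2} exp (2 π i n x / L)` on `[0, L]` and to zero
elsewhere. -/
def basisFun (L : ℝ) (n : ℤ) : ℝ → ℂ := (Icc 0 L).indicator (expFun L n)

/-- The trigonometric polynomial `∑ c_n U_n`, a function on the line supported in `[0, L]`. -/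
def trigFun (L : ℝ) (c : ℤ →₀ ℂ) : ℝ → ℂ := fun x => c.sum fun n a => a * basisFun L n x

/-- The involution `f^*(x) = conj (f (-x))`. -/
def involution (f : ℝ → ℂ) : ℝ → ℂ := fun x => conj (f (-x))

/-- `(f^* * g)(y) = ∫ f^*(x) g(y - x) dx`. -/
def starConv (f g : ℝ → ℂ) : ℝ → ℂ :=
  involution f ⋆[ContinuousLinearMap.mul ℝ ℂ, volume] g

lemma expFun_contDiff (L : ℝ) (n : ℤ) : ContDiff ℝ ∞ (expFun L n) := by
  unfold expFun
  have h : ContDiff ℝ ∞ (fun x : ℝ => (x : ℂ)) := Complex.ofRealCLM.contDiff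
  fun_prop

lemma trigFun_eq (L : ℝ) (c : ℤ →₀ ℂ) :
    trigFun L c = (Icc 0 L).indicator (fun x => ∑ n ∈ c.support, c n * expFun L n x) := by
  funext x
  by_cases hx : x ∈ Icc 0 L <;> simp [trigFun, basisFun, Finsupp.sum, hx]

lemma expFun_sub (L : ℝ) (n : ℤ) (x y : ℝ) :
    expFun L n (x - y) = expFun L n x * Complex.exp (-(2 * Real.pi * Complex.I * n * y / L)) := by
  unfold expFun
  rw [mul_assoc (((Real.sqrt L)⁻¹ : ℝ) : ℂ), ← Complex.exp_add]
  congr 2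
  push_cast
  ring

lemma primitive_contDiff {φ : ℝ → ℂ} (hφ : ContDiff ℝ ∞ φ) (a : ℝ) :
    ContDiff ℝ ∞ (fun y => ∫ x in a..y, φ x) := by
  have h : ∀ y, HasDerivAt (fun y => ∫ x in a..y, φ x) (φ y) y := fun y =>
    intervalIntegral.integral_hasDerivAt_right (hφ.continuous.intervalIntegrable _ _)
      (hφ.continuous.stronglyMeasurableAtFilter _ _) hφ.continuous.continuousAt
  rw [contDiff_infty_iff_deriv]
  refine ⟨fun y => (h y).differentiableAt, ?_⟩
  rwa [funext fun y => (h y).deriv]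

lemma starConv_apply (f g : ℝ → ℂ) (y : ℝ) :
    starConv f g y = ∫ x, conj (f (x - y)) * g x := by
  unfold starConv involution
  rw [← MeasureTheory.convolution_flip, MeasureTheory.convolution_def]
  congr 1
  funext t
  simp [mul_comm]

lemma contDiff_corr (L : ℝ) (a b : ℤ →₀ ℂ) {u v : ℝ → ℝ} (hu : ContDiff ℝ ∞ u)
    (hv : ContDiff ℝ ∞ v) :
    ContDiff ℝ ∞ (fun y => ∫ x in u y..v y, conj (∑ m ∈ a.support, a m * expFun L m (x - y)) *
      ∑ n ∈ b.support, b n * expFun L n x) := by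
  have hc : ∀ m n : ℤ, ContDiff ℝ ∞ (fun x => conj (expFun L m x) * expFun L n x) := fun m n =>
    (Complex.conjCLE.contDiff.comp (expFun_contDiff L m)).mul (expFun_contDiff L n)
  have key : (fun y => ∫ x in u y..v y, conj (∑ m ∈ a.support, a m * expFun L m (x - y)) *
      ∑ n ∈ b.support, b n * expFun L n x) = fun y : ℝ => ∑ m ∈ a.support, ∑ n ∈ b.support,
        (conj (a m * Complex.exp (-(2 * Real.pi * Complex.I * m * (y : ℝ) / L))) * b n) *
          ((∫ x in (0 : ℝ)..v y, conj (expFun L m x) * expFun L n x) -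
            ∫ x in (0 : ℝ)..u y, conj (expFun L m x) * expFun L n x) := by
    funext y
    have : ∀ x, conj (∑ m ∈ a.support, a m * expFun L m (x - y)) *
        ∑ n ∈ b.support, b n * expFun L n x = ∑ m ∈ a.support, ∑ n ∈ b.support,
        (conj (a m * Complex.exp (-(2 * Real.pi * Complex.I * m * y / L))) * b n) *
          (conj (expFun L m x) * expFun L n x) := by
      intro x
      rw [map_sum, Finset.sum_mul_sum]
      refine Finset.sum_congr rfl fun m _ => Finset.sum_congr rfl fun n _ => ?_
      rw [expFun_sub]
      simp only [map_mul]
      ring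
    simp only [this]
    rw [intervalIntegral.integral_finsetSum]
    · refine Finset.sum_congr rfl fun m _ => ?_
      rw [intervalIntegral.integral_finsetSum]
      · refine Finset.sum_congr rfl fun n _ => ?_
        rw [intervalIntegral.integral_const_mul, intervalIntegral.integral_interval_sub_left]
        · exact (hc m n).continuous.intervalIntegrable _ _
        · exact (hc m n).continuous.intervalIntegrable _ _
      · intro n _
        exact ((hc m n).continuous.const_mul _).intervalIntegrable _ _
    · intro m _
      refine Continuous.intervalIntegrable ?_ _ _
      exact continuous_finsetSum _ fun n _ => (hc m n).continuous.const_mul _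
  rw [key]
  refine ContDiff.sum fun m _ => ContDiff.sum fun n _ => ?_
  refine ContDiff.mul (ContDiff.mul ?_ contDiff_const) (ContDiff.sub ?_ ?_)
  · refine Complex.conjCLE.contDiff.comp ?_
    have h : ContDiff ℝ ∞ (fun x : ℝ => (x : ℂ)) := Complex.ofRealCLM.contDiff
    fun_prop
  · exact (primitive_contDiff (hc m n) 0).comp hv
  · exact (primitive_contDiff (hc m n) 0).comp hu

lemma starConv_trigFun (L : ℝ) (a b : ℤ →₀ ℂ) {y u v : ℝ} (huv : u ≤ v)
    (h : ∀ x, (x ∈ Icc 0 L ∧ x - y ∈ Icc 0 L) ↔ x ∈ Icc u v) :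
    starConv (trigFun L a) (trigFun L b) y =
      ∫ x in u..v, conj (∑ m ∈ a.support, a m * expFun L m (x - y)) *
        ∑ n ∈ b.support, b n * expFun L n x := by
  rw [starConv_apply, intervalIntegral.integral_of_le huv, ← integral_Icc_eq_integral_Ioc,
    ← integral_indicator measurableSet_Icc]
  congr 1
  funext x
  rw [trigFun_eq, trigFun_eq]
  by_cases hx : x ∈ Icc u v
  · rw [indicator_of_mem hx, indicator_of_mem ((h x).2 hx).1, indicator_of_mem ((h x).2 hx).2]
  · rw [indicator_of_notMem hx]
    by_cases h1 : x ∈ Icc 0 L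
    · have h2 : x - y ∉ Icc 0 L := fun h2 => hx ((h x).1 ⟨h1, h2⟩)
      rw [indicator_of_notMem h2]
      simp
    · rw [indicator_of_notMem h1]
      simp

lemma starConv_mem (L : ℝ) (a b : ℤ →₀ ℂ) :
    starConv (trigFun L a) (trigFun L b) ∈ piecewiseSmoothOn L := by
  constructor
  · refine (contDiff_corr L a b (u := fun y => y) (v := fun _ => L) contDiff_id
      contDiff_const).contDiffOn.congr ?_
    intro y hy
    refine starConv_trigFun L a b hy.2 fun x => ?_
    simp only [mem_Icc] at hy ⊢
    constructor
    · rintro ⟨⟨_, _⟩, _, _⟩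
      constructor <;> linarith
    · rintro ⟨_, _⟩
      refine ⟨⟨?_, ?_⟩, ?_, ?_⟩ <;> linarith
  · refine (contDiff_corr L a b (u := fun _ => 0) (v := fun y => L + y) contDiff_const
      (contDiff_const.add contDiff_id)).contDiffOn.congr ?_
    intro y hy
    refine starConv_trigFun L a b (by linarith [hy.1]) fun x => ?_
    simp only [mem_Icc] at hy ⊢
    constructor
    · rintro ⟨⟨_, _⟩, _, _⟩
      constructor <;> linarith
    · rintro ⟨_, _⟩
      refine ⟨⟨?_, ?_⟩, ?_, ?_⟩ <;> linarith

/-- The Hermitian form `⟨f | g⟩_Q = D̃(f^* * g)` on trigonometric polynomials, given by their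
coefficients. -/
def formQ {L : ℝ} (D : RealDistribution L) (a b : ℤ →₀ ℂ) : ℂ :=
  D.symm ⟨starConv (trigFun L a) (trigFun L b), starConv_mem L a b⟩

/-! ### The operator on `L²([0, L])` -/

/-- The Hilbert space `L²([0, L], dx)`. -/
abbrev L2 (L : ℝ) : Type := Lp ℂ 2 (volume.restrict (Icc (0 : ℝ) L))

lemma trigFun_memLp (L : ℝ) (c : ℤ →₀ ℂ) :
    MemLp (trigFun L c) 2 (volume.restrict (Icc (0 : ℝ) L)) := by
  rw [trigFun_eq]
  have hc : Continuous (fun x => ∑ n ∈ c.support, c n * expFun L n x) :=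
    continuous_finsetSum _ fun n _ => (expFun_contDiff L n).continuous.const_mul _
  obtain ⟨C, hC⟩ := isCompact_Icc.exists_bound_of_continuousOn (s := Icc (0 : ℝ) L) hc.continuousOn
  refine MemLp.of_bound (hc.aestronglyMeasurable.indicator measurableSet_Icc) C ?_
  filter_upwards [ae_restrict_mem measurableSet_Icc] with x hx
  rw [indicator_of_mem hx]
  exact hC x hx

/-- The class of a trigonometric polynomial in `L²([0, L])`. -/
def trigL2 (L : ℝ) (c : ℤ →₀ ℂ) : L2 L := (trigFun_memLp L c).toLp

/-- `T` is the operator defined by the form of `D`: its domain is the space of trigonometric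
polynomials, and `⟨f | T g⟩ = ⟨f | g⟩_Q` for all trigonometric polynomials `f`, `g`. There is at
most one such `T`, because trigonometric polynomials are dense. -/
structure IsOperatorOf {L : ℝ} (D : RealDistribution L) (T : L2 L →ₗ.[ℂ] L2 L) : Prop where
  domain_eq : (T.domain : Set (L2 L)) = Set.range (trigL2 L)
  inner_eq : ∀ (a b : ℤ →₀ ℂ) (hb : trigL2 L b ∈ T.domain),
    ⟪trigL2 L a, T ⟨trigL2 L b, hb⟩⟫_ℂ = formQ D a b

section Operators

variable {H : Type*} [NormedAddCommGroup H] [InnerProductSpace ℂ H]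

/-- `T ≥ c` for some real `c`, in the sense of forms. -/
def IsLowerBounded (T : H →ₗ.[ℂ] H) : Prop :=
  ∃ c : ℝ, ∀ f : T.domain, c * ‖(f : H)‖ ^ 2 ≤ (⟪(f : H), T f⟫_ℂ).re

/-- A densely defined, closable operator whose closure is selfadjoint. -/
def IsEssentiallySelfAdjoint [CompleteSpace H] (T : H →ₗ.[ℂ] H) : Prop :=
  Dense (T.domain : Set H) ∧ T.IsClosable ∧ IsSelfAdjoint T.closure

/-- `z` is in the resolvent set of `A` if `A - z` has a bounded two-sided inverse. -/
def resolventSet (A : H →ₗ.[ℂ] H) : Set ℂ :=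
  {z | ∃ R : H →L[ℂ] H,
    (∀ x : H, ∃ h : R x ∈ A.domain, A ⟨R x, h⟩ - z • R x = x) ∧
    ∀ y : A.domain, R (A y - z • (y : H)) = y}

/-- The spectrum of an unbounded operator. -/
def spectrum (A : H →ₗ.[ℂ] H) : Set ℂ := (resolventSet A)ᶜ

/-- The eigenspace `{x ∈ dom A | A x = μ x}`. -/
def eigenspace (A : H →ₗ.[ℂ] H) (μ : ℂ) : Submodule ℂ H :=
  (LinearMap.ker (A.toFun - μ • A.domain.subtype)).map A.domain.subtype

end Operators

/-- `f` is invariant under `x ↦ L - x`. -/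
def IsEvenL2 {L : ℝ} (f : L2 L) : Prop :=
  ∀ᵐ x ∂(volume.restrict (Icc (0 : ℝ) L)), f (L - x) = f x

/-- The Fourier transform `z ↦ ∫ f(x) exp(-i z x) dx` of `f` extended by zero. -/
def fourier {L : ℝ} (f : L2 L) (z : ℂ) : ℂ :=
  ∫ x in Icc (0 : ℝ) L, f x * Complex.exp (-Complex.I * z * x)

end DistForm

end

/-!
In the orthonormal basis of trigonometric functions, the form has off-diagonal matrix entries
`q m n = (b n - b m) / (m - n)` (`sub_mul_formQ_single`), so that its commutator with `diag n` has
rank two. If `x n` are the coordinates of `ξ`, the Fourier transform of `ξ` at a point `z` off the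
real line is a nonzero multiple of `∑ x n / (n - w)` with `w = z L / (2 π)`
(`exists_inner_expL2_trigL2`), and one has to exclude that this sum vanishes.

Suppose it vanishes, and let `g` be the vector with coordinates `x n / (n - w)`. The commutation
relation and `A ξ = λ ξ` show that the matrix sends `g` to `λ g + B h`, where `B` is a scalar and
`h` has coordinates `1 / (n - w)`. As `A` is the adjoint of `T`, this puts `g` in the domain of `A`
with `A g = λ g + B h`. Symmetry of `A`, applied to `g` and `ξ`, gives `B = 0` or `⟪h, ξ⟫ = 0`. In
the second case `⟪h, g⟫ = 0`, again because `∑ x n / (n - w) = 0`, so that `⟪g, (A - λ) g⟫ = 0`; as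
`A ≥ λ`, this forces `(A - λ) g = 0`. In both cases `g` lies in the eigenspace spanned by `ξ`.
Since the numbers `n - w` are distinct, `ξ` has a single nonzero coordinate, and then the sum is
not zero (`not_hasSum_zero_of_loewner`).

That the least point of the spectrum is a lower bound of `A` is proved without the spectral
theorem: the best lower bound of a symmetric operator belongs to its spectrum
(`le_re_inner_of_isLeast_spectrum`).
-/

noncomputable section

namespace DistForm

/-! ### Unbounded selfadjoint operators -/

section Operators

variable {H : Type*} [NormedAddCommGroup H] [InnerProductSpace ℂ H]

lemma mem_eigenspace_iff {A : H →ₗ.[ℂ] H} {μ : ℂ} {x : H} :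
    x ∈ eigenspace A μ ↔ ∃ h : x ∈ A.domain, A ⟨x, h⟩ = μ • x := by
  simp only [eigenspace, Submodule.mem_map, LinearMap.mem_ker, LinearMap.sub_apply,
    LinearMap.smul_apply, Submodule.subtype_apply, LinearPMap.toFun_eq_coe, sub_eq_zero]
  constructor
  · rintro ⟨y, hy, rfl⟩
    exact ⟨y.2, hy⟩
  · rintro ⟨h, hx⟩
    exact ⟨⟨x, h⟩, hx, rfl⟩

/-- A closed condition on pairs `(x, T x)` passes to the graph of the closure of `T`. -/
lemma closure_mem_of_isClosed {T : H →ₗ.[ℂ] H} (hT : T.IsClosable) {S : Set (H × H)}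
    (hS : IsClosed S) (h : ∀ x : T.domain, ((x : H), T x) ∈ S) (x : T.closure.domain) :
    ((x : H), T.closure x) ∈ S := by
  have hx : ((x : H), T.closure x) ∈ (T.graph.topologicalClosure : Set (H × H)) := by
    rw [hT.graph_closure_eq_closure_graph]
    exact T.closure.mem_graph x
  rw [Submodule.topologicalClosure_coe] at hx
  refine closure_minimal ?_ hS hx
  intro p hp
  obtain ⟨y, hy⟩ := (LinearPMap.mem_graph_iff' T).1 hp
  rw [← hy]
  exact h y

lemma IsLowerBounded.closure {T : H →ₗ.[ℂ] H} (hT : T.IsClosable) (h : IsLowerBounded T) :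
    IsLowerBounded T.closure := by
  obtain ⟨c, hc⟩ := h
  refine ⟨c, fun x => ?_⟩
  have hS : IsClosed {p : H × H | c * ‖p.1‖ ^ 2 ≤ (⟪p.1, p.2⟫_ℂ).re} :=
    isClosed_le (by fun_prop) (by fun_prop)
  exact closure_mem_of_isClosed hT hS hc x

lemma re_inner_sub_smul (x v : H) (t : ℝ) :
    (⟪x, v - (t : ℂ) • x⟫_ℂ).re = (⟪x, v⟫_ℂ).re - t * ‖x‖ ^ 2 := by
  rw [inner_sub_right, inner_smul_right, inner_self_eq_norm_sq_to_K, Complex.sub_re,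
    Complex.re_ofReal_mul]
  congr 2
  exact_mod_cast Complex.ofReal_re _

/-- Cauchy–Schwarz inequality for the positive form `⟪x, (A - t) y⟫` of a symmetric operator
`A ≥ t`. -/
lemma norm_inner_sub_smul_sq_le {A : H →ₗ.[ℂ] H} (hA : A.IsFormalAdjoint A) {t : ℝ}
    (ht : ∀ x : A.domain, t * ‖(x : H)‖ ^ 2 ≤ (⟪(x : H), A x⟫_ℂ).re) (x y : A.domain) :
    ‖⟪(x : H), A y - (t : ℂ) • (y : H)⟫_ℂ‖ ^ 2 ≤
      (⟪(x : H), A x - (t : ℂ) • (x : H)⟫_ℂ).re * (⟪(y : H), A y - (t : ℂ) • (y : H)⟫_ℂ).re := by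
  have hsymm : ∀ x y : A.domain, conj ⟪(y : H), A x - (t : ℂ) • (x : H)⟫_ℂ =
      ⟪(x : H), A y - (t : ℂ) • (y : H)⟫_ℂ := by
    intro x y
    rw [inner_conj_symm, inner_sub_left, inner_sub_right, hA x y, inner_smul_left,
      inner_smul_right, Complex.conj_ofReal]
  let core : PreInnerProductSpace.Core ℂ A.domain :=
    { inner := fun x y => ⟪(x : H), A y - (t : ℂ) • (y : H)⟫_ℂ
      conj_inner_symm := hsymm
      re_inner_nonneg := fun x => by
        change 0 ≤ (⟪(x : H), A x - (t : ℂ) • (x : H)⟫_ℂ).re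
        rw [re_inner_sub_smul]
        exact sub_nonneg.2 (ht x)
      add_left := fun x y z => inner_add_left _ _ _
      smul_left := fun x y r => inner_smul_left _ _ _ }
  have h := @InnerProductSpace.Core.inner_mul_inner_self_le ℂ A.domain _ _ _ core x y
  have h2 : ‖core.inner y x‖ = ‖core.inner x y‖ := by
    rw [← core.conj_inner_symm x y, RCLike.norm_conj]
  change ‖core.inner x y‖ * ‖core.inner y x‖ ≤ _ at h
  rw [h2, ← sq] at h
  exact h

/-- A vector on which the positive form of `A - t` vanishes is killed by `A - t`. -/
lemma eq_smul_of_re_inner_eq_zero {A : H →ₗ.[ℂ] H} (hA : A.IsFormalAdjoint A)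
    (hd : Dense (A.domain : Set H)) {t : ℝ}
    (ht : ∀ x : A.domain, t * ‖(x : H)‖ ^ 2 ≤ (⟪(x : H), A x⟫_ℂ).re) (y : A.domain)
    (hy : ⟪(y : H), A y - (t : ℂ) • (y : H)⟫_ℂ = 0) : A y = (t : ℂ) • (y : H) := by
  rw [← sub_eq_zero]
  refine hd.eq_zero_of_inner_right ℂ fun v hv => ?_
  have h := norm_inner_sub_smul_sq_le hA ht ⟨v, hv⟩ y
  rw [hy, Complex.zero_re, mul_zero] at h
  exact norm_eq_zero.1 (pow_eq_zero_iff two_ne_zero |>.1 (le_antisymm h (sq_nonneg _)))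

/-- If a symmetric `A ≥ t` has `t` in its resolvent set, then `A ≥ t + ε` for some `ε > 0`: with
`R = (A - t)⁻¹` one has `‖y‖² ≤ ‖R‖ ⟪y, (A - t) y⟫`, from the Cauchy–Schwarz inequality for
`⟪y, (A - t) (R y)⟫ = ‖y‖²`. -/
lemma exists_lt_lowerBound_of_mem_resolventSet {A : H →ₗ.[ℂ] H} (hA : A.IsFormalAdjoint A)
    {t : ℝ} (ht : ∀ x : A.domain, t * ‖(x : H)‖ ^ 2 ≤ (⟪(x : H), A x⟫_ℂ).re)
    (hres : (t : ℂ) ∈ resolventSet A) :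
    ∃ s > t, ∀ x : A.domain, s * ‖(x : H)‖ ^ 2 ≤ (⟪(x : H), A x⟫_ℂ).re := by
  obtain ⟨R, hR, -⟩ := hres
  refine ⟨t + (‖R‖ + 1)⁻¹, by linarith [inv_pos.2 (by positivity : 0 < ‖R‖ + 1)], fun y => ?_⟩
  obtain ⟨hmem, hRy⟩ := hR y
  have h := norm_inner_sub_smul_sq_le hA ht y ⟨R y, hmem⟩
  have hpos := ht y
  set q : ℝ := (⟪(y : H), A y - (t : ℂ) • (y : H)⟫_ℂ).re
  have hq' : q = (⟪(y : H), A y⟫_ℂ).re - t * ‖(y : H)‖ ^ 2 :=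
    re_inner_sub_smul _ _ _
  have hq0 : 0 ≤ q := by linarith
  dsimp only at h
  rw [hRy, inner_self_eq_norm_sq_to_K] at h
  have h1 : (⟪R (y : H), (y : H)⟫_ℂ).re ≤ ‖R‖ * ‖(y : H)‖ ^ 2 := by
    calc (⟪R (y : H), (y : H)⟫_ℂ).re ≤ ‖R (y : H)‖ * ‖(y : H)‖ :=
          re_inner_le_norm (𝕜 := ℂ) _ _
      _ ≤ (‖R‖ * ‖(y : H)‖) * ‖(y : H)‖ := by gcongr; exact R.le_opNorm _
      _ = _ := by ring
  have h2 : (‖(y : H)‖ ^ 2) ^ 2 ≤ q * (‖R‖ * ‖(y : H)‖ ^ 2) := by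
    refine le_trans (le_of_eq ?_) (h.trans (mul_le_mul_of_nonneg_left h1 hq0))
    simp
  have h3 : ‖(y : H)‖ ^ 2 ≤ (‖R‖ + 1) * q := by
    rcases eq_or_lt_of_le (sq_nonneg ‖(y : H)‖) with h0 | h0
    · rw [← h0]; positivity
    · have : ‖(y : H)‖ ^ 2 ≤ ‖R‖ * q := by
        refine le_of_mul_le_mul_right ?_ h0
        linarith
      linarith
  have h4 : (‖R‖ + 1)⁻¹ * ‖(y : H)‖ ^ 2 ≤ q := by
    rw [inv_mul_le_iff₀ (by positivity)]
    exact h3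
  linarith

/-- A lower-bounded symmetric operator is bounded below by the least real point of its spectrum:
the best lower bound belongs to the spectrum. -/
lemma le_re_inner_of_isLeast_spectrum {A : H →ₗ.[ℂ] H} (hA : A.IsFormalAdjoint A)
    (hb : IsLowerBounded A) (hne : ∃ x : A.domain, (x : H) ≠ 0) {lam : ℝ}
    (hmin : IsLeast {t : ℝ | (t : ℂ) ∈ spectrum A} lam) (x : A.domain) :
    lam * ‖(x : H)‖ ^ 2 ≤ (⟪(x : H), A x⟫_ℂ).re := by
  set S : Set ℝ := {t | ∀ x : A.domain, t * ‖(x : H)‖ ^ 2 ≤ (⟪(x : H), A x⟫_ℂ).re} with hS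
  have hSne : S.Nonempty := hb
  obtain ⟨x₀, hx₀⟩ := hne
  have hx₀' : 0 < ‖(x₀ : H)‖ ^ 2 := by positivity
  have hSbdd : BddAbove S := by
    refine ⟨(⟪(x₀ : H), A x₀⟫_ℂ).re / ‖(x₀ : H)‖ ^ 2, fun t ht => ?_⟩
    rw [le_div_iff₀ hx₀']
    exact ht x₀
  have hSclosed : IsClosed S := by
    have : S = ⋂ x : A.domain, {t : ℝ | t * ‖(x : H)‖ ^ 2 ≤ (⟪(x : H), A x⟫_ℂ).re} := by
      ext t; simp [hS]
    rw [this]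
    exact isClosed_iInter fun x => isClosed_le (by fun_prop) (by fun_prop)
  have hmem : sSup S ∈ S := hSclosed.csSup_mem hSne hSbdd
  have hspec : ((sSup S : ℝ) : ℂ) ∈ spectrum A := by
    intro hres
    obtain ⟨s, hs, hs'⟩ := exists_lt_lowerBound_of_mem_resolventSet hA hmem hres
    exact absurd (le_csSup hSbdd hs') (not_le.2 hs)
  calc lam * ‖(x : H)‖ ^ 2 ≤ sSup S * ‖(x : H)‖ ^ 2 := by
        gcongr
        exact hmin.2 hspec
    _ ≤ _ := hmem x

lemma exists_inner_eq_of_norm_le {ι : Type*} (e : HilbertBasis ι ℂ H) (ξ : H) {a : ι → ℂ} {C : ℝ}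
    (h : ∀ n, ‖a n‖ ≤ C * ‖⟪e n, ξ⟫_ℂ‖) : ∃ g : H, ∀ n, ⟪e n, g⟫_ℂ = a n := by
  have hmem : Memℓp a 2 := by
    have h1 := ((lp.memℓp (e.repr ξ)).summable (by simp)).mul_left (C ^ 2)
    refine memℓp_gen (h1.of_nonneg_of_le (fun n => by positivity) fun n => ?_)
    have h2 := pow_le_pow_left₀ (norm_nonneg _) (h n) 2
    rw [e.repr_apply_apply]
    simpa [mul_pow] using h2
  refine ⟨e.repr.symm ⟨a, hmem⟩, fun n => ?_⟩
  rw [← e.repr_apply_apply, LinearIsometryEquiv.apply_symm_apply]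

variable [CompleteSpace H]

lemma IsEssentiallySelfAdjoint.isFormalAdjoint_closure {T : H →ₗ.[ℂ] H}
    (h : IsEssentiallySelfAdjoint T) : T.closure.IsFormalAdjoint T.closure := by
  have h1 := LinearPMap.adjoint_isFormalAdjoint h.2.2.dense_domain
  rwa [LinearPMap.isSelfAdjoint_def.1 h.2.2] at h1

/-- The closure of an essentially selfadjoint `T` is the adjoint of `T`; it suffices to test on a
family that spans the domain of `T`. -/
lemma IsEssentiallySelfAdjoint.closure_apply_of_inner {T : H →ₗ.[ℂ] H}
    (h : IsEssentiallySelfAdjoint T) {ι : Type*} {e : ι → H} (he : ∀ n, e n ∈ T.domain)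
    (hspan : T.domain ≤ Submodule.span ℂ (range e)) {y u : H}
    (hyu : ∀ n, ⟪T ⟨e n, he n⟩, y⟫_ℂ = ⟪e n, u⟫_ℂ) :
    ∃ hy : y ∈ T.closure.domain, T.closure ⟨y, hy⟩ = u := by
  have h1 : ∀ x : T.domain, ⟪T x, y⟫_ℂ = ⟪(x : H), u⟫_ℂ := by
    rintro ⟨x, hx⟩
    induction hspan hx using Submodule.span_induction with
    | mem x hx' =>
      obtain ⟨n, rfl⟩ := hx'
      exact hyu n
    | zero =>
      have : (⟨0, hx⟩ : T.domain) = 0 := rfl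
      rw [this]; simp
    | add x z hx' hz' ihx ihz =>
      have hle : Submodule.span ℂ (range e) ≤ T.domain :=
        Submodule.span_le.2 (range_subset_iff.2 he)
      have : (⟨x + z, hx⟩ : T.domain) = ⟨x, hle hx'⟩ + ⟨z, hle hz'⟩ := rfl
      rw [this, LinearPMap.map_add, inner_add_left, ihx, ihz]
      exact (inner_add_left _ _ _).symm
    | smul a x hx' ih =>
      have hle : Submodule.span ℂ (range e) ≤ T.domain :=
        Submodule.span_le.2 (range_subset_iff.2 he)
      have : (⟨a • x, hx⟩ : T.domain) = a • ⟨x, hle hx'⟩ := rfl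
      rw [this, LinearPMap.map_smul, inner_smul_left, ih]
      exact (inner_smul_left _ _ _).symm
  have h2 : ∀ x : T.closure.domain, ⟪u, (x : H)⟫_ℂ = ⟪y, T.closure x⟫_ℂ := by
    have hS : IsClosed {p : H × H | ⟪u, p.1⟫_ℂ = ⟪y, p.2⟫_ℂ} :=
      isClosed_eq (by fun_prop) (by fun_prop)
    refine closure_mem_of_isClosed h.2.1 hS fun x => ?_
    change ⟪u, (x : H)⟫_ℂ = ⟪y, T x⟫_ℂ
    rw [← inner_conj_symm u, ← inner_conj_symm y, h1 x]
  have hy : y ∈ T.closure.adjoint.domain := LinearPMap.mem_adjoint_domain_of_exists y ⟨u, h2⟩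
  have hy' := LinearPMap.adjoint_apply_eq h.2.2.dense_domain ⟨y, hy⟩ h2
  have hgraph : (y, u) ∈ T.closure.adjoint.graph :=
    (LinearPMap.mem_graph_iff _).2 ⟨⟨y, hy⟩, rfl, hy'⟩
  rw [LinearPMap.isSelfAdjoint_def.1 h.2.2] at hgraph
  obtain ⟨⟨z, hz⟩, hz1, hz2⟩ := (LinearPMap.mem_graph_iff _).1 hgraph
  dsimp only at hz1 hz2
  subst hz1
  exact ⟨hz, hz2⟩

/-! ### Operators with a Loewner-type matrix -/

/-- Let `e` be a Hilbert basis of `H` in which the essentially selfadjoint operator `T` has matrix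
entries `(b n - b m) / (m - n)` off the diagonal, and let `ξ = ∑ x n • e n` span the lowest
eigenspace of the closure. If `w` is not real, then `∑ x n / (n - w)` does not vanish. The vector
`h = ∑ (n - w)⁻¹ • e n` of `H` is an argument of the lemma. -/
lemma not_hasSum_zero_of_loewner {T : H →ₗ.[ℂ] H} (hT : IsEssentiallySelfAdjoint T)
    (hbdd : IsLowerBounded T) (e : HilbertBasis ℤ ℂ H) (he : ∀ n, e n ∈ T.domain)
    (hspan : T.domain ≤ Submodule.span ℂ (range e)) (b : ℤ → ℂ)
    (hb : ∀ m n : ℤ, ((m : ℂ) - n) * ⟪e m, T ⟨e n, he n⟩⟫_ℂ = b n - b m)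
    {lam : ℝ} (hmin : IsLeast {t : ℝ | (t : ℂ) ∈ spectrum T.closure} lam)
    (hsimple : Module.finrank ℂ (eigenspace T.closure lam) = 1)
    {ξ : H} (hξ : ξ ∈ eigenspace T.closure lam) (hξ0 : ξ ≠ 0)
    {w : ℂ} (hw : w.im ≠ 0) {h : H} (hh : ∀ n : ℤ, ⟪e n, h⟫_ℂ = ((n : ℂ) - w)⁻¹) :
    ¬ HasSum (fun n : ℤ => ⟪e n, ξ⟫_ℂ / ((n : ℂ) - w)) 0 := by
  intro hsum
  set x : ℤ → ℂ := fun n => ⟪e n, ξ⟫_ℂ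
  have hnw : ∀ n : ℤ, (n : ℂ) - w ≠ 0 := by
    intro n h0
    apply hw
    rw [← sub_eq_zero.1 h0]
    simp
  -- `g` is the image of `ξ` under the inverse of `diag (n - w)`.
  obtain ⟨g, hg⟩ : ∃ g : H, ∀ n, ⟪e n, g⟫_ℂ = x n / ((n : ℂ) - w) := by
    refine exists_inner_eq_of_norm_le e ξ (C := |w.im|⁻¹) fun n => ?_
    rw [norm_div, div_eq_inv_mul]
    refine mul_le_mul_of_nonneg_right (inv_anti₀ (abs_pos.2 hw) ?_) (norm_nonneg _)
    simpa using Complex.abs_im_le_norm ((n : ℂ) - w)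
  have hg0 : HasSum (fun n : ℤ => ⟪e n, g⟫_ℂ) 0 := by simpa only [hg] using hsum
  have hsa := hT.isFormalAdjoint_closure
  obtain ⟨hξd, hξe⟩ := mem_eigenspace_iff.1 hξ
  have hle : T ≤ T.closure := T.le_closure
  -- The rows `p n` of the matrix are square summable, being the coordinates of `T (e n)`.
  set p : ℤ → ℤ → ℂ := fun n m => ⟪T ⟨e n, he n⟩, e m⟫_ℂ
  have hpb : ∀ n m : ℤ, ((m : ℂ) - n) * p n m = conj (b n) - conj (b m) := by
    intro n m
    have := congrArg conj (hb m n)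
    rw [map_mul, inner_conj_symm] at this
    simpa using this
  have hpx : ∀ n, HasSum (fun m => p n m * x m) (lam * x n) := by
    intro n
    have h1 := e.hasSum_inner_mul_inner (T ⟨e n, he n⟩) ξ
    have h2 : ⟪T ⟨e n, he n⟩, ξ⟫_ℂ = lam * x n := by
      rw [hle.2 (x := ⟨e n, he n⟩) (y := ⟨e n, hle.1 (he n)⟩) rfl, hsa ⟨e n, hle.1 (he n)⟩ ⟨ξ, hξd⟩,
        hξe, inner_smul_right]
    rwa [h2] at h1
  -- The series `∑ conj (b m) * g m` converges because `b m = b 0 - m * conj (p 0 m)`.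
  obtain ⟨B, hB⟩ : ∃ B, HasSum (fun m : ℤ => conj (b m) * ⟪e m, g⟫_ℂ) B := by
    have h1 := ((hg0.mul_left (conj (b 0))).sub (hpx 0)).sub
      ((e.hasSum_inner_mul_inner (T ⟨e 0, he 0⟩) g).mul_left w)
    refine ⟨_, h1.congr_fun ?_⟩
    intro m
    have h2 := hpb 0 m
    have h3 : conj (b m) = conj (b 0) - m * p 0 m := by
      simp only [Int.cast_zero, sub_zero] at h2
      rw [h2, sub_sub_cancel]
    have h4 : x m = ((m : ℂ) - w) * ⟪e m, g⟫_ℂ := by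
      rw [hg, mul_div_cancel₀ _ (hnw m)]
    change _ = conj (b 0) * ⟪e m, g⟫_ℂ - p 0 m * x m - w * (p 0 m * ⟪e m, g⟫_ℂ)
    rw [h3, h4]
    ring
  -- Commuting `diag (n - w)⁻¹` with the matrix costs a rank two operator, half of which
  -- disappears since `∑ g m = 0`.
  obtain ⟨hgd, hge⟩ : ∃ hgd : g ∈ T.closure.domain,
      T.closure ⟨g, hgd⟩ = (lam : ℂ) • g + B • h := by
    refine hT.closure_apply_of_inner he hspan fun n => ?_
    have h1 := e.hasSum_inner_mul_inner (T ⟨e n, he n⟩) g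
    have h2 := (((hpx n).add hB).sub (hg0.mul_left (conj (b n)))).div_const ((n : ℂ) - w)
    refine (h1.unique (h2.congr_fun ?_)).trans ?_
    · intro m
      have h3 := hpb n m
      change p n m * _ = (p n m * x m + conj (b m) * ⟪e m, g⟫_ℂ - conj (b n) * ⟪e m, g⟫_ℂ) / _
      have h4 : x m = ((m : ℂ) - w) * ⟪e m, g⟫_ℂ := by
        rw [hg, mul_div_cancel₀ _ (hnw m)]
      rw [eq_div_iff (hnw n), h4]
      linear_combination ⟪e m, g⟫_ℂ * (-h3)
    · rw [inner_add_right, inner_smul_right, inner_smul_right, hh, hg]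
      field_simp
      ring
  have hd : Dense (T.closure.domain : Set H) := hT.2.2.dense_domain
  -- `g` is an eigenvector: either `B = 0`, or `⟪g, (A - lam) g⟫` vanishes.
  have hgA : T.closure ⟨g, hgd⟩ = (lam : ℂ) • g := by
    by_cases hB0 : B = 0
    · rw [hge, hB0, zero_smul, add_zero]
    refine eq_smul_of_re_inner_eq_zero hsa hd
      (le_re_inner_of_isLeast_spectrum hsa (hbdd.closure hT.2.1) ⟨⟨ξ, hξd⟩, hξ0⟩ hmin) ⟨g, hgd⟩ ?_
    have h1 : ⟪h, ξ⟫_ℂ = 0 := by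
      have h2 := hsa ⟨g, hgd⟩ ⟨ξ, hξd⟩
      dsimp only at h2
      rw [hge, hξe, inner_add_left, inner_smul_left, inner_smul_left, inner_smul_right,
        Complex.conj_ofReal, add_eq_left, mul_eq_zero] at h2
      exact h2.resolve_left (by simpa using hB0)
    have h2 : ⟪h, g⟫_ℂ = 0 := by
      have h3 := hg0.sub ((e.hasSum_inner_mul_inner h g).mul_left (w - conj w))
      have h4 := (e.hasSum_inner_mul_inner h ξ).unique (h3.congr_fun (fun n => ?_))
      · rw [h1, zero_sub, eq_comm, neg_eq_zero, mul_eq_zero] at h4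
        refine h4.resolve_left fun h5 => hw ?_
        have := congrArg Complex.im h5
        simp at this
        linarith
      · have h5 : ⟪e n, ξ⟫_ℂ = ((n : ℂ) - w) * ⟪e n, g⟫_ℂ := by
          rw [hg, mul_div_cancel₀ _ (hnw n)]
        have h6 : ((n : ℂ) - conj w) * ⟪h, e n⟫_ℂ = 1 := by
          rw [← inner_conj_symm, hh, map_inv₀, map_sub, map_intCast]
          refine mul_inv_cancel₀ fun h7 => hnw n ?_
          have := congrArg conj h7
          simpa using this
        rw [h5]
        linear_combination ⟪e n, g⟫_ℂ * h6
    dsimp only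
    rw [hge, add_sub_cancel_left, inner_smul_right, ← inner_conj_symm, h2]
    simp
  -- Hence `g = c • ξ`, so that `x` has a single nonzero entry, contradicting `∑ g n = 0`.
  have hgE : g ∈ eigenspace T.closure lam := mem_eigenspace_iff.2 ⟨hgd, hgA⟩
  obtain ⟨c, hc⟩ : ∃ c : ℂ, c • ξ = g := by
    obtain ⟨c, hc⟩ := (finrank_eq_one_iff_of_nonzero' (⟨ξ, hξ⟩ : eigenspace T.closure lam)
      (by simpa [Subtype.ext_iff] using hξ0)).1 hsimple ⟨g, hgE⟩
    exact ⟨c, congrArg Subtype.val hc⟩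
  have hxg : ∀ n, x n / ((n : ℂ) - w) = c * x n := by
    intro n
    rw [← hg, ← hc, inner_smul_right]
  obtain ⟨n₀, hn₀⟩ : ∃ n, x n ≠ 0 := by
    by_contra! hall
    refine hξ0 (e.repr.injective ?_)
    ext n
    rw [e.repr_apply_apply, map_zero]
    exact hall n
  have hval : ∀ n, x n ≠ 0 → (n : ℂ) - w = c⁻¹ := by
    intro n hn
    have h1 := hxg n
    rw [div_eq_mul_inv, mul_comm] at h1
    rw [← mul_right_cancel₀ hn h1, inv_inv]
  have hsingle : ∀ n, n ≠ n₀ → x n / ((n : ℂ) - w) = 0 := by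
    intro n hn
    by_contra hne
    have h1 := hval n fun h0 => hne (by rw [h0, zero_div])
    have h2 := h1.trans (hval n₀ hn₀).symm
    exact hn (by exact_mod_cast sub_left_injective h2)
  have h1 := hsum.unique (hasSum_single n₀ hsingle)
  exact div_ne_zero hn₀ (hnw n₀) h1.symm

end Operators

/-! ### The matrix of the form -/

/-- A distribution on `[0, L]` depends only on the restriction of functions to `[0, L]`. -/
lemma RealDistribution.toLinearMap_congr {L : ℝ} (D : RealDistribution L) {f g : smoothOn L}
    (h : EqOn (f : ℝ → ℂ) g (Icc 0 L)) : D.toLinearMap f = D.toLinearMap g := by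
  rw [← sub_eq_zero, ← map_sub, ← norm_le_zero_iff]
  obtain ⟨N, C, hC⟩ := D.continuous'
  refine (hC (f - g) 0 fun k _ x hx => ?_).trans_eq (mul_zero C)
  have h0 : EqOn ((f - g : smoothOn L) : ℝ → ℂ) (fun _ => 0) (Icc 0 L) := fun y hy =>
    sub_eq_zero.2 (h hy)
  rw [iteratedDerivWithin_congr h0 hx]
  simp

/-- The value of a distribution on the normalized exponential of frequency `n`. -/
def expValue {L : ℝ} (D : RealDistribution L) (n : ℤ) : ℂ :=
  D.toLinearMap ⟨expFun L n, (expFun_contDiff L n).contDiffOn⟩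

lemma RealDistribution.mul_toLinearMap_eq {L : ℝ} (D : RealDistribution L) (f : smoothOn L)
    {c d : ℂ} {m n : ℤ}
    (h : ∀ x ∈ Icc (0 : ℝ) L, c * (f : ℝ → ℂ) x = d * (expFun L m x - expFun L n x)) :
    c * D.toLinearMap f = d * (expValue D m - expValue D n) := by
  have := D.toLinearMap_congr (f := c • f)
    (g := d • ((⟨expFun L m, (expFun_contDiff L m).contDiffOn⟩ : smoothOn L) -
      (⟨expFun L n, (expFun_contDiff L n).contDiffOn⟩ : smoothOn L))) h
  rwa [map_smul, map_smul, map_sub] at this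

lemma expFun_eq {L : ℝ} (n : ℤ) (x : ℝ) : expFun L n x =
    ((Real.sqrt L)⁻¹ : ℝ) * Complex.exp (2 * Real.pi * Complex.I * n / L * x) := by
  rw [expFun]
  congr 2
  ring

lemma conj_expFun (L : ℝ) (n : ℤ) (x : ℝ) : conj (expFun L n x) = expFun L (-n) x := by
  rw [expFun, expFun, map_mul, Complex.conj_ofReal, ← Complex.exp_conj]
  congr 2
  simp [map_ofNat]

lemma expFun_neg (L : ℝ) (n : ℤ) (x : ℝ) : expFun L n (-x) = expFun L (-n) x := by
  rw [expFun, expFun]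
  congr 2
  push_cast
  ring

lemma expFun_mul {L : ℝ} (hL : 0 < L) (m n : ℤ) (x : ℝ) :
    (Real.sqrt L : ℂ) * (expFun L m x * expFun L n x) = expFun L (m + n) x := by
  have hs : (Real.sqrt L : ℂ) ≠ 0 := by exact_mod_cast (Real.sqrt_pos.2 hL).ne'
  have : Complex.exp (2 * Real.pi * Complex.I * ((m + n : ℤ) : ℂ) * x / L) =
      Complex.exp (2 * Real.pi * Complex.I * m * x / L) *
        Complex.exp (2 * Real.pi * Complex.I * n * x / L) := by
    rw [← Complex.exp_add]
    congr 1
    push_cast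
    ring
  simp only [expFun, this]
  push_cast
  field_simp

lemma expFun_period {L : ℝ} (hL : 0 < L) (n : ℤ) (x : ℝ) : expFun L n (L + x) = expFun L n x := by
  have hL' : (L : ℂ) ≠ 0 := by exact_mod_cast hL.ne'
  rw [expFun, expFun]
  congr 1
  rw [← Complex.exp_periodic.int_mul n (2 * Real.pi * Complex.I * n * x / L)]
  congr 1
  push_cast
  field_simp
  ring

/-- The correlation integral of two exponentials of different frequencies. -/
lemma integral_conj_expFun_sub_mul {L : ℝ} (hL : 0 < L) {m n : ℤ} (hmn : m ≠ n) (u v y : ℝ) :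
    2 * Real.pi * Complex.I * ((n : ℂ) - m) *
        ∫ x in u..v, conj (expFun L m (x - y)) * expFun L n x =
      L * (expFun L m y * (expFun L (n - m) v - expFun L (n - m) u)) := by
  have hL' : (L : ℂ) ≠ 0 := by exact_mod_cast hL.ne'
  have hs : (Real.sqrt L : ℂ) ≠ 0 := by exact_mod_cast (Real.sqrt_pos.2 hL).ne'
  have hnm : (n : ℂ) - m ≠ 0 := sub_ne_zero.2 (by exact_mod_cast hmn.symm)
  have h1 : ∀ x : ℝ, conj (expFun L m (x - y)) * expFun L n x =
      expFun L m y * (((Real.sqrt L)⁻¹ : ℝ) *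
        Complex.exp (2 * Real.pi * Complex.I * ((n : ℂ) - m) / L * x)) := by
    intro x
    have h2 : conj (Complex.exp (-(2 * Real.pi * Complex.I * m * y / L))) =
        Complex.exp (2 * Real.pi * Complex.I * m * y / L) := by
      rw [← Complex.exp_conj]
      simp [map_ofNat, neg_div]
    have h3 := expFun_mul hL (-m) n x
    have h4 := expFun_eq (L := L) (-m + n) x
    rw [expFun_sub, map_mul, conj_expFun, h2]
    have h5 : Complex.exp (2 * Real.pi * Complex.I * m * y / L) =
        Real.sqrt L * expFun L m y := by
      rw [expFun]; push_cast; field_simp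
    rw [h5]
    calc _ = expFun L m y * (Real.sqrt L * (expFun L (-m) x * expFun L n x)) := by ring
      _ = _ := by
        rw [h3, h4]
        push_cast
        ring_nf
  have hc : 2 * Real.pi * Complex.I * ((n : ℂ) - m) / L ≠ 0 :=
    div_ne_zero (mul_ne_zero Complex.two_pi_I_ne_zero hnm) hL'
  simp only [h1]
  rw [intervalIntegral.integral_const_mul, intervalIntegral.integral_const_mul,
    integral_exp_mul_complex hc, expFun_eq (n - m) v, expFun_eq (n - m) u]
  push_cast
  have := Complex.two_pi_I_ne_zero
  field_simp

lemma sum_single_expFun (L : ℝ) (n : ℤ) (x : ℝ) :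
    ∑ k ∈ (Finsupp.single n (1 : ℂ)).support, Finsupp.single n (1 : ℂ) k * expFun L k x =
      expFun L n x := by
  simp [Finsupp.support_single]

/-- The off-diagonal matrix entries of the form are `(b n - b m) / (m - n)`, where `b n` is
`√L (D (expFun L n) - D (expFun L (-n))) / (2 π i)`. Indeed, for `0 ≤ y ≤ L`, the correlation of
the basis functions of frequencies `m ≠ n` is proportional to `expFun L m y - expFun L n y` at `y`
and to `expFun L (-n) y - expFun L (-m) y` at `-y`. -/
lemma sub_mul_formQ_single {L : ℝ} (hL : 0 < L) (D : RealDistribution L) (m n : ℤ) :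
    ((m : ℂ) - n) * formQ D (Finsupp.single m 1) (Finsupp.single n 1) =
      Real.sqrt L * (expValue D n - expValue D (-n)) / (2 * Real.pi * Complex.I) -
        Real.sqrt L * (expValue D m - expValue D (-m)) / (2 * Real.pi * Complex.I) := by
  rcases eq_or_ne m n with rfl | hmn
  · simp
  have hs : (Real.sqrt L : ℂ) ≠ 0 := by exact_mod_cast (Real.sqrt_pos.2 hL).ne'
  have hs2 : (Real.sqrt L : ℂ) * Real.sqrt L = L := by exact_mod_cast Real.mul_self_sqrt hL.le
  have hE0 : ∀ k : ℤ, expFun L k L = expFun L k 0 := fun k => by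
    simpa using expFun_period hL k 0
  have h00 : ∀ k : ℤ, Real.sqrt L * expFun L k 0 = 1 := fun k => by
    simp [expFun, hs]
  have h1 := D.mul_toLinearMap_eq (c := 2 * Real.pi * Complex.I * ((n : ℂ) - m))
    (d := Real.sqrt L) (m := m) (n := n)
    ⟨starConv (trigFun L (Finsupp.single m 1)) (trigFun L (Finsupp.single n 1)),
      (starConv_mem L _ _).1⟩ (fun y hy => by
        dsimp only
        rw [starConv_trigFun L _ _ hy.2 (fun x => by
          simp only [mem_Icc] at hy ⊢
          constructor
          · rintro ⟨⟨_, _⟩, _, _⟩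
            constructor <;> linarith
          · rintro ⟨_, _⟩
            refine ⟨⟨?_, ?_⟩, ?_, ?_⟩ <;> linarith)]
        simp only [sum_single_expFun]
        rw [integral_conj_expFun_sub_mul hL hmn, hE0]
        have h2 := h00 (n - m)
        have h3 := expFun_mul hL m (n - m) y
        rw [add_sub_cancel] at h3
        rw [← hs2]
        linear_combination Real.sqrt L * expFun L m y * h2 - Real.sqrt L * h3)
  have h2 := D.mul_toLinearMap_eq (c := 2 * Real.pi * Complex.I * ((n : ℂ) - m))
    (d := Real.sqrt L) (m := -n) (n := -m)
    ⟨fun x => starConv (trigFun L (Finsupp.single m 1)) (trigFun L (Finsupp.single n 1)) (-x),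
      reflect_mem ⟨_, starConv_mem L _ _⟩⟩ (fun y hy => by
        dsimp only
        rw [starConv_trigFun L _ _ (u := 0) (v := L + -y) (by linarith [hy.2]) (fun x => by
          simp only [mem_Icc] at hy ⊢
          constructor
          · rintro ⟨⟨_, _⟩, _, _⟩
            constructor <;> linarith
          · rintro ⟨_, _⟩
            refine ⟨⟨?_, ?_⟩, ?_, ?_⟩ <;> linarith)]
        simp only [sum_single_expFun]
        rw [integral_conj_expFun_sub_mul hL hmn, expFun_period hL, expFun_neg, expFun_neg]
        have h2 := h00 (n - m)
        have h3 := expFun_mul hL (-m) (-(n - m)) y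
        rw [show -m + -(n - m) = -n by ring] at h3
        rw [← hs2]
        linear_combination Real.sqrt L * h3 - Real.sqrt L * expFun L (-m) y * h2)
  rw [formQ, RealDistribution.symm]
  have hpi := Complex.two_pi_I_ne_zero
  rw [← sub_div, eq_div_iff hpi]
  linear_combination -h1 - h2

/-! ### The trigonometric basis of `L²([0, L])` -/

lemma memLp_of_continuous {f : ℝ → ℂ} (hf : Continuous f) (L : ℝ) :
    MemLp f 2 (volume.restrict (Icc (0 : ℝ) L)) := by
  obtain ⟨C, hC⟩ := isCompact_Icc.exists_bound_of_continuousOn (s := Icc (0 : ℝ) L) hf.continuousOn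
  refine MemLp.of_bound hf.aestronglyMeasurable C ?_
  filter_upwards [ae_restrict_mem measurableSet_Icc] with x hx using hC x hx

lemma trigL2_coe_ae (L : ℝ) (c : ℤ →₀ ℂ) :
    (trigL2 L c : ℝ → ℂ) =ᵐ[volume.restrict (Icc (0 : ℝ) L)]
      fun x => c.sum fun n a => a * expFun L n x := by
  filter_upwards [(trigFun_memLp L c).coeFn_toLp, ae_restrict_mem measurableSet_Icc] with x hx hx'
  rw [trigL2, hx, trigFun_eq, indicator_of_mem hx', Finsupp.sum]

lemma trigL2_single_coe_ae (L : ℝ) (n : ℤ) :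
    (trigL2 L (Finsupp.single n 1) : ℝ → ℂ) =ᵐ[volume.restrict (Icc (0 : ℝ) L)]
      expFun L n := by
  filter_upwards [trigL2_coe_ae L (Finsupp.single n 1)] with x hx
  rw [hx, Finsupp.sum_single_index] <;> simp

lemma trigL2_add (L : ℝ) (c d : ℤ →₀ ℂ) : trigL2 L (c + d) = trigL2 L c + trigL2 L d := by
  rw [trigL2, trigL2, trigL2, ← MemLp.toLp_add]
  congr 1
  funext x
  exact Finsupp.sum_add_index' (by simp) fun n a b => add_mul _ _ _

lemma trigL2_single (L : ℝ) (n : ℤ) (a : ℂ) :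
    trigL2 L (Finsupp.single n a) = a • trigL2 L (Finsupp.single n 1) := by
  rw [trigL2, trigL2, ← MemLp.toLp_const_smul]
  congr 1
  funext x
  simp [trigFun]

lemma trigL2_mem_span (L : ℝ) (c : ℤ →₀ ℂ) :
    trigL2 L c ∈ Submodule.span ℂ (range fun n : ℤ => trigL2 L (Finsupp.single n 1)) := by
  induction c using Finsupp.induction_linear with
  | zero =>
    have : trigL2 L 0 = 0 := by simpa using trigL2_add L 0 0
    rw [this]
    exact zero_mem _
  | add c d hc hd =>
    rw [trigL2_add]
    exact add_mem hc hd
  | single n a =>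
    rw [trigL2_single]
    exact Submodule.smul_mem _ _ (Submodule.subset_span ⟨n, rfl⟩)

/-- The Fourier transform of the exponential of frequency `n`. -/
lemma integral_exp_mul_expFun {L : ℝ} (hL : 0 < L) (z : ℂ) (n : ℤ)
    (hz : (n : ℂ) - z * L / (2 * Real.pi) ≠ 0) :
    ∫ x in Icc (0 : ℝ) L, Complex.exp (-Complex.I * z * x) * expFun L n x =
      Real.sqrt L / (2 * Real.pi * Complex.I) * (Complex.exp (-Complex.I * z * L) - 1) *
        ((n : ℂ) - z * L / (2 * Real.pi))⁻¹ := by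
  have hL' : (L : ℂ) ≠ 0 := by exact_mod_cast hL.ne'
  have hs : (Real.sqrt L : ℂ) ≠ 0 := by exact_mod_cast (Real.sqrt_pos.2 hL).ne'
  have hs2 : (Real.sqrt L : ℂ) * Real.sqrt L = L := by exact_mod_cast Real.mul_self_sqrt hL.le
  have hpi : (Real.pi : ℂ) ≠ 0 := by exact_mod_cast Real.pi_ne_zero
  set c : ℂ := 2 * Real.pi * Complex.I / L * ((n : ℂ) - z * L / (2 * Real.pi)) with hc
  have hc0 : c ≠ 0 := mul_ne_zero (div_ne_zero Complex.two_pi_I_ne_zero hL') hz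
  have hc' : c = 2 * Real.pi * Complex.I * n / L - Complex.I * z := by
    rw [hc]; field_simp
  have h1 : ∀ x : ℝ, Complex.exp (-Complex.I * z * x) * expFun L n x =
      ((Real.sqrt L)⁻¹ : ℝ) * Complex.exp (c * x) := by
    intro x
    rw [expFun_eq, mul_left_comm, ← Complex.exp_add, hc']
    congr 2
    ring
  have h2 : Complex.exp (c * L) = Complex.exp (-Complex.I * z * L) := by
    rw [← Complex.exp_periodic.int_mul n (-Complex.I * z * L), hc']
    congr 1
    field_simp
    ring
  simp only [h1]
  rw [integral_Icc_eq_integral_Ioc, ← intervalIntegral.integral_of_le hL.le,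
    intervalIntegral.integral_const_mul, integral_exp_mul_complex hc0, h2]
  rw [Complex.ofReal_zero, mul_zero, Complex.exp_zero, hc, ← hs2]
  push_cast
  have := Complex.I_ne_zero
  field_simp

lemma orthonormal_trigL2 {L : ℝ} (hL : 0 < L) :
    Orthonormal ℂ fun n : ℤ => trigL2 L (Finsupp.single n 1) := by
  have hL' : (L : ℂ) ≠ 0 := by exact_mod_cast hL.ne'
  have hs : (Real.sqrt L : ℂ) ≠ 0 := by exact_mod_cast (Real.sqrt_pos.2 hL).ne'
  have hs2 : (Real.sqrt L : ℂ) * Real.sqrt L = L := by exact_mod_cast Real.mul_self_sqrt hL.le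
  have hpi : (Real.pi : ℂ) ≠ 0 := by exact_mod_cast Real.pi_ne_zero
  have hinner : ∀ m n : ℤ, ⟪trigL2 L (Finsupp.single m 1), trigL2 L (Finsupp.single n 1)⟫_ℂ =
      ∫ x in Icc (0 : ℝ) L, conj (expFun L m x) * expFun L n x := by
    intro m n
    rw [L2.inner_def]
    refine integral_congr_ae ?_
    filter_upwards [trigL2_single_coe_ae L m, trigL2_single_coe_ae L n] with x hm hn
    rw [hm, hn, RCLike.inner_apply, mul_comm]
  rw [orthonormal_iff_ite]
  intro m n
  rw [hinner]
  split_ifs with hmn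
  · subst hmn
    have h1 : ∀ x, conj (expFun L m x) * expFun L m x = (L : ℂ)⁻¹ := by
      intro x
      have h2 := expFun_mul hL (-m) m x
      rw [← conj_expFun] at h2
      have h3 : expFun L (-m + m) x = (Real.sqrt L : ℂ)⁻¹ := by simp [expFun]
      rw [h3] at h2
      rw [← hs2, mul_inv, ← eq_inv_mul_iff_mul_eq₀ hs |>.2 h2]
    simp only [h1]
    simp [Measure.real, hL.le, hL']
  · have h1 : ∀ x, conj (expFun L m x) * expFun L n x = ((Real.sqrt L)⁻¹ : ℝ) *
        (Complex.exp (-Complex.I * ((2 * Real.pi * m / L : ℝ) : ℂ) * x) * expFun L n x) := by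
      intro x
      rw [conj_expFun, expFun_eq (-m), mul_assoc]
      congr 3
      push_cast
      ring
    have hmn' : (n : ℂ) - ((2 * Real.pi * m / L : ℝ) : ℂ) * L / (2 * Real.pi) = n - m := by
      push_cast
      field_simp
    simp only [h1]
    rw [integral_const_mul, integral_exp_mul_expFun hL]
    · have h2 : Complex.exp (-Complex.I * ((2 * Real.pi * m / L : ℝ) : ℂ) * L) = 1 := by
        rw [Complex.exp_eq_one_iff]
        refine ⟨-m, ?_⟩
        push_cast
        field_simp
      rw [h2]
      simp
    · rw [hmn']
      exact sub_ne_zero.2 (by exact_mod_cast Ne.symm hmn)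

/-! ### The Fourier transform -/

/-- The class of `x ↦ exp (i (conj z) x)`, which represents the Fourier transform at `z` as an
inner product. -/
def expL2 (L : ℝ) (z : ℂ) : L2 L :=
  (memLp_of_continuous (f := fun x : ℝ => Complex.exp (Complex.I * conj z * x))
    (by fun_prop) L).toLp

lemma inner_expL2 {L : ℝ} (z : ℂ) (f : L2 L) :
    ⟪expL2 L z, f⟫_ℂ = ∫ x in Icc (0 : ℝ) L, f x * Complex.exp (-Complex.I * z * x) := by
  rw [L2.inner_def]
  refine integral_congr_ae ?_
  filter_upwards [(memLp_of_continuous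
    (f := fun x : ℝ => Complex.exp (Complex.I * conj z * x)) (by fun_prop) L).coeFn_toLp] with x hx
  rw [expL2, hx, RCLike.inner_apply, ← Complex.exp_conj]
  simp

lemma inner_expL2_trigL2 {L : ℝ} (hL : 0 < L) (z : ℂ) (n : ℤ)
    (hz : (n : ℂ) - z * L / (2 * Real.pi) ≠ 0) :
    ⟪expL2 L z, trigL2 L (Finsupp.single n 1)⟫_ℂ =
      Real.sqrt L / (2 * Real.pi * Complex.I) * (Complex.exp (-Complex.I * z * L) - 1) *
        ((n : ℂ) - z * L / (2 * Real.pi))⁻¹ := by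
  rw [inner_expL2, ← integral_exp_mul_expFun hL z n hz]
  refine integral_congr_ae ?_
  filter_upwards [trigL2_single_coe_ae L n] with x hx
  rw [hx, mul_comm]

lemma exp_neg_I_mul_mul_ne_one {L : ℝ} (hL : 0 < L) {z : ℂ} (hz : z.im ≠ 0) :
    Complex.exp (-Complex.I * z * L) ≠ 1 := by
  intro h
  have h1 := congrArg norm h
  rw [Complex.norm_exp, norm_one, Real.exp_eq_one_iff] at h1
  simp at h1
  exact h1.elim hz hL.ne'

lemma im_mul_div_two_pi_ne_zero {L : ℝ} (hL : 0 < L) {z : ℂ} (hz : z.im ≠ 0) :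
    (z * L / (2 * Real.pi)).im ≠ 0 := by
  have h1 : z * L / (2 * Real.pi) = z * ((L / (2 * Real.pi) : ℝ) : ℂ) := by
    push_cast; ring
  rw [h1, Complex.im_mul_ofReal]
  exact mul_ne_zero hz (by positivity)

/-- Off the real line, the exponential has coordinates proportional to `1 / (n - z L / (2 π))`. -/
lemma exists_inner_expL2_trigL2 {L : ℝ} (hL : 0 < L) {z : ℂ} (hz : z.im ≠ 0) :
    ∃ C : ℂ, C ≠ 0 ∧ ∀ n : ℤ, ⟪expL2 L z, trigL2 L (Finsupp.single n 1)⟫_ℂ =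
      C * ((n : ℂ) - z * L / (2 * Real.pi))⁻¹ := by
  have hs : (Real.sqrt L : ℂ) ≠ 0 := by exact_mod_cast (Real.sqrt_pos.2 hL).ne'
  refine ⟨_, mul_ne_zero (div_ne_zero hs Complex.two_pi_I_ne_zero)
    (sub_ne_zero.2 (exp_neg_I_mul_mul_ne_one hL hz)), fun n => inner_expL2_trigL2 hL z n ?_⟩
  intro h0
  apply im_mul_div_two_pi_ne_zero hL hz
  rw [← sub_eq_zero.1 h0]
  simp

lemma differentiable_fourier {L : ℝ} (f : L2 L) : Differentiable ℂ (fourier f) := by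
  intro z₀
  have hf : Integrable f (volume.restrict (Icc (0 : ℝ) L)) :=
    (Lp.memLp f).integrable one_le_two
  set R : ℝ := ‖z₀‖ + 1
  have hRpos : 0 < R := by positivity
  have hbound : ∀ z ∈ Metric.ball z₀ 1, ∀ x ∈ Icc (0 : ℝ) L,
      ‖Complex.exp (-Complex.I * z * x)‖ ≤ Real.exp (R * L) := by
    intro z hz x hx
    refine (Complex.norm_exp_le_exp_norm _).trans (Real.exp_le_exp.2 ?_)
    have h1 : ‖z‖ ≤ R := by
      have := norm_sub_norm_le z z₀
      rw [Metric.mem_ball, dist_eq_norm] at hz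
      linarith
    rw [norm_mul, norm_mul, norm_neg, Complex.norm_I, one_mul, Complex.norm_real, Real.norm_eq_abs,
      abs_of_nonneg hx.1]
    exact mul_le_mul h1 hx.2 hx.1 hRpos.le
  have hmeas : ∀ z : ℂ, AEStronglyMeasurable (fun x : ℝ => f x * Complex.exp (-Complex.I * z * x))
      (volume.restrict (Icc (0 : ℝ) L)) := fun z =>
    hf.aestronglyMeasurable.mul (Continuous.aestronglyMeasurable (by fun_prop))
  refine (hasDerivAt_integral_of_dominated_loc_of_deriv_le (𝕜 := ℂ)
    (F := fun z x => f x * Complex.exp (-Complex.I * z * x))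
    (F' := fun z x => f x * (Complex.exp (-Complex.I * z * x) * (-Complex.I * x)))
    (bound := fun x => ‖f x‖ * (Real.exp (R * L) * L))
    (Metric.ball_mem_nhds z₀ one_pos) (Filter.Eventually.of_forall hmeas) ?_ ?_ ?_ ?_ ?_
    ).2.differentiableAt
  · refine (hf.norm.mul_const (Real.exp (R * L))).mono' (hmeas z₀) ?_
    filter_upwards [ae_restrict_mem measurableSet_Icc] with x hx
    rw [norm_mul]
    exact mul_le_mul_of_nonneg_left (hbound z₀ (Metric.mem_ball_self one_pos) x hx) (norm_nonneg _)
  · exact hf.aestronglyMeasurable.mul (Continuous.aestronglyMeasurable (by fun_prop))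
  · filter_upwards [ae_restrict_mem measurableSet_Icc] with x hx z hz
    rw [norm_mul, norm_mul]
    refine mul_le_mul_of_nonneg_left ?_ (norm_nonneg _)
    refine mul_le_mul (hbound z hz x hx) ?_ (norm_nonneg _) (Real.exp_pos _).le
    simpa [abs_of_nonneg hx.1] using hx.2
  · exact hf.norm.mul_const _
  · refine Filter.Eventually.of_forall fun x z _ => ?_
    have h1 : HasDerivAt (fun z : ℂ => -Complex.I * z * x) (-Complex.I * x) z := by
      simpa using ((hasDerivAt_id z).const_mul (-Complex.I)).mul_const (x : ℂ)
    exact h1.cexp.const_mul (f x)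

/-- The Fourier transform of a ground state of the operator of `D` has no zero off the real line. -/
lemma fourier_ne_zero_of_im_ne_zero {L : ℝ} (hL : 0 < L) {D : RealDistribution L}
    {T : L2 L →ₗ.[ℂ] L2 L} (hT : IsOperatorOf D T)
    (hbdd : IsLowerBounded T) (hess : IsEssentiallySelfAdjoint T)
    {lam : ℝ} (hmin : IsLeast {t : ℝ | (t : ℂ) ∈ spectrum T.closure} lam)
    (hsimple : Module.finrank ℂ (eigenspace T.closure lam) = 1)
    {ξ : L2 L} (hξ : ξ ∈ eigenspace T.closure lam) (hξ0 : ξ ≠ 0) {z : ℂ} (hzim : z.im ≠ 0) :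
    fourier ξ z ≠ 0 := by
  intro hz
  have hdom : ∀ n : ℤ, trigL2 L (Finsupp.single n 1) ∈ T.domain := fun n => by
    rw [← SetLike.mem_coe, hT.domain_eq]
    exact mem_range_self _
  have hspan : T.domain ≤
      Submodule.span ℂ (range fun n : ℤ => trigL2 L (Finsupp.single n 1)) := by
    intro f hf
    rw [← SetLike.mem_coe, hT.domain_eq] at hf
    obtain ⟨c, rfl⟩ := hf
    exact trigL2_mem_span L c
  -- The trigonometric system is complete because the domain of `T` is dense.
  have hdense : ⊤ ≤ (Submodule.span ℂ
      (range fun n : ℤ => trigL2 L (Finsupp.single n 1))).topologicalClosure := by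
    rw [← (Submodule.dense_iff_topologicalClosure_eq_top.1 hess.1)]
    exact Submodule.topologicalClosure_mono hspan
  set e := HilbertBasis.mk (orthonormal_trigL2 hL) hdense with he
  have hen : ∀ n, e n = trigL2 L (Finsupp.single n 1) := fun n => by rw [he, HilbertBasis.coe_mk]
  set w : ℂ := z * L / (2 * Real.pi) with hw
  have hwim : w.im ≠ 0 := im_mul_div_two_pi_ne_zero hL hzim
  have hwc : conj z * L / (2 * Real.pi) = conj w := by simp [hw, map_ofNat]
  obtain ⟨C, hC0, hC⟩ := exists_inner_expL2_trigL2 hL hzim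
  obtain ⟨C', hC0', hC'⟩ := exists_inner_expL2_trigL2 hL (z := conj z) (by simpa using hzim)
  -- `∑ (n - w)⁻¹ • e n` is a multiple of the function `exp (i z x)`.
  have hh : ∀ n : ℤ, ⟪e n, (conj C')⁻¹ • expL2 L (conj z)⟫_ℂ = ((n : ℂ) - w)⁻¹ := by
    intro n
    rw [inner_smul_right, hen, ← inner_conj_symm, hC', hwc, map_mul,
      inv_mul_cancel_left₀ (by simpa using hC0')]
    simp
  refine not_hasSum_zero_of_loewner hess hbdd e (fun n => by rw [hen]; exact hdom n)
    (by rw [he, HilbertBasis.coe_mk]; exact hspan)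
    (fun n => Real.sqrt L * (expValue D n - expValue D (-n)) / (2 * Real.pi * Complex.I))
    (fun m n => ?_) hmin hsimple hξ hξ0 hwim hh ?_
  · rw [← sub_mul_formQ_single hL D m n, ← hT.inner_eq _ _ (hdom n)]
    simp only [hen]
  · have h1 := e.hasSum_inner_mul_inner (expL2 L z) ξ
    rw [inner_expL2] at h1
    change HasSum _ (fourier ξ z) at h1
    rw [hz] at h1
    have h2 := h1.mul_left C⁻¹
    rw [mul_zero] at h2
    refine h2.congr_fun fun n => ?_
    rw [hen, hC, div_eq_inv_mul, mul_assoc, inv_mul_cancel_left₀ hC0]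

end DistForm

end

theorem theorem7p1 (L : ℝ) (hL : 0 < L) (D : DistForm.RealDistribution L)
    (T : DistForm.L2 L →ₗ.[ℂ] DistForm.L2 L) (hT : DistForm.IsOperatorOf D T)
    (hbdd : DistForm.IsLowerBounded T) (hess : DistForm.IsEssentiallySelfAdjoint T)
    (lam : ℝ) (hmin : IsLeast {t : ℝ | (t : ℂ) ∈ DistForm.spectrum T.closure} lam)
    (hiso : ∃ U ∈ 𝓝 (lam : ℂ), DistForm.spectrum T.closure ∩ U = {(lam : ℂ)})
    (hsimple : Module.finrank ℂ (DistForm.eigenspace T.closure lam) = 1)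
    (ξ : DistForm.L2 L) (hξ : ξ ∈ DistForm.eigenspace T.closure lam) (hξ0 : ξ ≠ 0)
    (heven : DistForm.IsEvenL2 ξ) :
    Differentiable ℂ (DistForm.fourier ξ) ∧
      ∀ z : ℂ, DistForm.fourier ξ z = 0 → z.im = 0 := by
  refine ⟨DistForm.differentiable_fourier ξ, fun z hz => ?_⟩
  by_contra hzim
  exact DistForm.fourier_ne_zero_of_im_ne_zero hL hT hbdd hess hmin hsimple hξ hξ0 hzim hz
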